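/- Let $X$ be a nonempty Tychonoff space, and let $C_p(X)$ be the space of continuous functions $X\to\mathbb R$ with the topology of pointwise convergence. Then the following are equivalent: 1. $C_p(X)$ satisfies $S_1(\mathcal S,\mathcal S)$; 2. $X$ satisfies $S_1(\Gamma_F,\Gamma)$, has property $V$, and is strongly zero-dimensional; 3. $X$ satisfies $S_1(\Gamma_{cl},\Gamma_{cl})$, has property $V$, and is strongly zero-dimensional; 4. $C_p(X)$ is sequentially separable and satisfies $S_1(\Gamma_f,\Gamma_f)$ for every $f\in C_p(X)$; 5. $C_p(X)$ is sequentially separable and satisfies $S_1(\mathcal S,\Gamma_f)$ for every $f\in C_p(X)$. Here $S_1(\mathcal A,\mathcal B)$ means: for every sequence $(A_n)_{n}$ of elements of $\mathcal A$ there are $b_n\in A_n$ such that $\{b_n:n\in\mathbb N\}\in\mathcal B$. A subset $D$ of a space is *sequentially dense* if every point of the space is the limit of a sequence of points of $D$; $\mathcal S$ is the family of all sequentially dense subsets of $C_p(X)$, and a space is *sequentially separable* if it has a countable sequentially dense subset. For $f\in C_p(X)$, $\Gamma_f$ is the family of all infinite sets $A\subseteq C_p(X)$ with $f\notin A$ such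 that $A\setminus U$ is finite for every neighbourhood $U$ of $f$. A *$\gamma$-cover* of $X$ is an infinite family $\mathcal U$ of subsets of $X$ with $X\notin\mathcal U$ and $\bigcup\mathcal U=X$ such that each $x\in X$ belongs to all but finitely many elements of $\mathcal U$. $\Gamma$ (respectively $\Gamma_{cl}$) is the family of $\gamma$-covers by open (respectively clopen) sets. A *zero-set* is a set $g^{-1}(0)$ with $g:X\to\mathbb R$ continuous, and a *cozero-set* is the complement of a zero-set. $\Gamma_F$ is the family of $\gamma$-covers $\mathcal U$ by cozero-sets for which there are zero-sets $F(U)\subseteq U$ $(U\in\mathcal U)$ such that $\{F(U):U\in\mathcal U\}$ is a $\gamma$-cover of $X$. $X$ has *property $V$* if there is a continuous bijection $h$ from $X$ onto a separable metric space $Y$ such that $h(U)$ is an $F_\sigma$-set in $Y$ for every cozero-set $U$ of $X$. $X$ is *strongly zero-dimensional* if every finite cover of $X$ by cozero-sets has a finite refinement which is a cover of $X$ by pairwise disjoint open sets. -/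

import Mathlib

universe u

namespace SelCp

/-- The selection principle `S₁(𝒜, ℬ)`. -/
def S1 {α : Type u} (A B : Set (Set α)) : Prop :=
  ∀ s : ℕ → Set α, (∀ n, s n ∈ A) → ∃ b : ℕ → α, (∀ n, b n ∈ s n) ∧ Set.range b ∈ B

/-- The space `C_p(X)` of continuous real functions on `X`. Its topology is the one inherited from
the product `X → ℝ`, that is, the topology of pointwise convergence. -/
abbrev Cp (X : Type u) [TopologicalSpace X] : Type u := {f : X → ℝ // Continuous f}

section Points

variable (T : Type u) [TopologicalSpace T]

/-- The family `𝒮` of sequentially dense subsets of `T`: every point of `T` is the limit of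
a sequence of points of the set. -/
def seqDenseSets : Set (Set T) := {D | seqClosure D = Set.univ}

/-- `T` has a countable sequentially dense subset. -/
def SeqSeparable : Prop := ∃ D : Set T, D.Countable ∧ D ∈ seqDenseSets T

variable {T} in
/-- The family `Γ_x` of the infinite sets `A` with `x ∉ A` that converge to `x`: every neighbourhood
of `x` contains all but finitely many elements of `A`. -/
def gammaAt (x : T) : Set (Set T) :=
  {A | A.Infinite ∧ x ∉ A ∧ ∀ U ∈ nhds x, (A \ U).Finite}

end Points

/-- `γ`-covers of a set `X` by arbitrary subsets; covers are nontrivial, `X ∉ 𝒰`. -/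
def IsGammaCover {X : Type u} (𝒰 : Set (Set X)) : Prop :=
  ⋃₀ 𝒰 = Set.univ ∧ Set.univ ∉ 𝒰 ∧ 𝒰.Infinite ∧ ∀ x : X, {U ∈ 𝒰 | x ∉ U}.Finite

section Covers

/-- The zero-set of a continuous real function. -/
def IsZeroSet {X : Type u} [TopologicalSpace X] (Z : Set X) : Prop :=
  ∃ f : X → ℝ, Continuous f ∧ Z = {x | f x = 0}

/-- Cozero-sets (functionally open sets). -/
def IsCozeroSet {X : Type u} [TopologicalSpace X] (U : Set X) : Prop := IsZeroSet Uᶜ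

/-- `F_σ`-sets: countable unions of closed sets. -/
def IsFsigma {Y : Type u} [TopologicalSpace Y] (s : Set Y) : Prop :=
  ∃ F : ℕ → Set Y, (∀ n, IsClosed (F n)) ∧ s = ⋃ n, F n

variable (X : Type u) [TopologicalSpace X]

/-- The family `Γ` of open `γ`-covers of `X`. -/
def openGamma : Set (Set (Set X)) := {𝒰 | IsGammaCover 𝒰 ∧ ∀ U ∈ 𝒰, IsOpen U}

/-- The family `Γ_cl` of clopen `γ`-covers of `X`. -/
def clopenGamma : Set (Set (Set X)) := {𝒰 | IsGammaCover 𝒰 ∧ ∀ U ∈ 𝒰, IsClopen U}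

/-- The family `Γ_F` of `γ_F`-shrinkable `γ`-covers of `X`: the `γ`-covers `𝒰` by cozero-sets for
which there is a `γ`-cover `{F(U) : U ∈ 𝒰}` by zero-sets with `F(U) ⊆ U` for all `U ∈ 𝒰`. -/
def shrinkableGamma : Set (Set (Set X)) :=
  {𝒰 | IsGammaCover 𝒰 ∧ (∀ U ∈ 𝒰, IsCozeroSet U) ∧
    ∃ F : Set X → Set X, (∀ U ∈ 𝒰, IsZeroSet (F U) ∧ F U ⊆ U) ∧ IsGammaCover (F '' 𝒰)}

/-- Strong zero-dimensionality: every finite cover of `X` by cozero-sets has a finite open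
refinement that consists of pairwise disjoint sets (and covers `X`). -/
def StronglyZeroDimensional : Prop :=
  ∀ (n : ℕ) (U : Fin n → Set X), (∀ i, IsCozeroSet (U i)) → ⋃ i, U i = Set.univ →
    ∃ (m : ℕ) (V : Fin m → Set X), (∀ j, IsOpen (V j)) ∧ (∀ j, ∃ i, V j ⊆ U i) ∧
      ⋃ j, V j = Set.univ ∧ Pairwise fun j k => Disjoint (V j) (V k)

/-- Property `V`: there is a condensation (continuous bijection) of `X` onto a separable metric
space which maps cozero-sets to `F_σ`-sets. (The space `Y` has the cardinality of `X`, so that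
taking it in the universe of `X` is no restriction.) -/
def PropertyV : Prop :=
  ∃ (Y : Type u) (_ : MetricSpace Y) (_ : TopologicalSpace.SeparableSpace Y) (f : X → Y),
    Continuous f ∧ Function.Bijective f ∧ ∀ U : Set X, IsCozeroSet U → IsFsigma (f '' U)

end Covers

end SelCp

namespace SelCp

open Set Filter Topology

/-! Everything passes through two diagonal principles for sequences of continuous functions tending
pointwise to `0`. The weak one, `DiagonalLtOne`, follows from each of the three selection principles
on `C_p(X)`. It gives S₁(Γ_F, Γ) by separating zero-sets from cozero-sets with functions. It also
gives strong zero-dimensionality: a real function whose image contains `[0, 1]` could be composed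
with a map covering the Hilbert cube, and bumps on the coordinates would then defeat every selection
(`DiagonalLtOne.exists_missed`). So each function omits a value in `[0, 1]`, and omitted values cut
out clopen sets.

Conversely, strong zero-dimensionality replaces "small" by "in a clopen set", so S₁(Γ_cl, Γ_cl)
yields the strong principle `DiagonalZero`. By it iterated limits in `C_p(X)` are diagonal limits,
whence all three selection principles, given sequential separability.

Sequential separability gives property V by evaluation on a countable sequentially dense set. The
converse uses `DiagonalZero` and a countable family of functions, the cascades, which imitate step
functions on closed sets of the metric image. -/

section Selection

variable (X : Type u) [TopologicalSpace X]

/-- Every sequence of sequences of continuous functions, each converging pointwise to `0`,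
has a diagonal selection that converges pointwise to `0`. -/
def DiagonalZero : Prop :=
  ∀ g : ℕ → ℕ → X → ℝ, (∀ n m, Continuous (g n m)) →
    (∀ n x, Tendsto (fun m => g n m x) atTop (𝓝 0)) →
    ∃ σ : ℕ → ℕ, ∀ x, Tendsto (fun n => g n (σ n) x) atTop (𝓝 0)

/-- Every sequence of sequences of continuous functions with values at most `1`, each converging
pointwise to `0`, has a diagonal selection that is pointwise eventually smaller than `1`. -/
def DiagonalLtOne : Prop :=
  ∀ g : ℕ → ℕ → X → ℝ, (∀ n m, Continuous (g n m)) → (∀ n m x, g n m x ≤ 1) →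
    (∀ n x, Tendsto (fun m => g n m x) atTop (𝓝 0)) →
    ∃ σ : ℕ → ℕ, ∀ x, ∀ᶠ n in atTop, g n (σ n) x < 1

end Selection

/-! ### Convergent sequences and the families `Γ_f` -/

section Points

variable {X : Type u} [TopologicalSpace X]

theorem tendsto_Cp_iff {ι : Type*} {l : Filter ι} {b : ι → Cp X} {f : Cp X} :
    Tendsto b l (𝓝 f) ↔ ∀ x, Tendsto (fun i => (b i).1 x) l (𝓝 (f.1 x)) := by
  rw [tendsto_subtype_rng, tendsto_pi_nhds]

/-- A convergent sequence takes each value other than its limit only finitely often. -/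
theorem finite_fiber_of_tendsto {T : Type*} [TopologicalSpace T] [T1Space T] {b : ℕ → T} {f a : T}
    (h : Tendsto b atTop (𝓝 f)) (ha : a ≠ f) : (b ⁻¹' {a}).Finite := by
  have : ∀ᶠ n in atTop, b n ≠ a := h.eventually_ne ha.symm
  rw [← Nat.cofinite_eq_atTop] at this
  exact (Filter.eventually_cofinite.1 this).subset fun n hn => not_not_intro hn

/-- The range of a nontrivial sequence converging to `f` belongs to `Γ_f`. -/
theorem range_mem_gammaAt {T : Type u} [TopologicalSpace T] [T1Space T] {b : ℕ → T} {f : T}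
    (h : Tendsto b atTop (𝓝 f)) (hb : ∀ n, b n ≠ f) : range b ∈ gammaAt f := by
  refine ⟨fun hfin => ?_, by simpa using hb, fun U hU => ?_⟩
  · have huniv : (univ : Set ℕ) = ⋃ a ∈ range b, b ⁻¹' {a} := by
      ext n; simp
    have : (univ : Set ℕ).Finite := by
      rw [huniv]
      refine hfin.biUnion ?_
      rintro _ ⟨n, rfl⟩
      exact finite_fiber_of_tendsto h (hb n)
    exact Set.infinite_univ this
  · have : ∀ᶠ n in cofinite, b n ∈ U := by
      rw [Nat.cofinite_eq_atTop]; exact h hU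
    refine ((Filter.eventually_cofinite.1 this).image b).subset ?_
    rintro _ ⟨⟨n, rfl⟩, hn⟩
    exact ⟨n, hn, rfl⟩

/-- A set in `Γ_f` contains an injective sequence converging to `f`. -/
theorem exists_seq_of_mem_gammaAt {T : Type u} [TopologicalSpace T] {A : Set T} {f : T}
    (hA : A ∈ gammaAt f) :
    ∃ b : ℕ → T, Function.Injective b ∧ (∀ n, b n ∈ A) ∧ Tendsto b atTop (𝓝 f) := by
  obtain ⟨hinf, -, hU⟩ := hA
  refine ⟨fun n => hinf.natEmbedding A n, fun i j hij => ?_, fun n => (hinf.natEmbedding A n).2, ?_⟩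
  · exact (hinf.natEmbedding A).injective (Subtype.ext hij)
  · rw [← Nat.cofinite_eq_atTop]
    intro U hUf
    refine ((hU U hUf).preimage ?_ : Set.Finite _).subset (s := (fun n =>
      (hinf.natEmbedding A n : T)) ⁻¹' (A \ U)) ?_
    · exact fun i _ j _ hij => (hinf.natEmbedding A).injective (Subtype.ext hij)
    · exact fun n hn => ⟨(hinf.natEmbedding A n).2, hn⟩

/-- If the terms of `b` differ from `f`, then a sequence in the range of `b` converging to `f`
lists terms of `b` whose indices tend to infinity. -/
theorem exists_index_tendsto {T : Type u} [TopologicalSpace T] [T1Space T] {b c : ℕ → T} {f : T}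
    (hb : ∀ n, b n ≠ f) (hc : ∀ k, c k ∈ range b) (h : Tendsto c atTop (𝓝 f)) :
    ∃ ν : ℕ → ℕ, Tendsto ν atTop atTop ∧ Tendsto (fun k => b (ν k)) atTop (𝓝 f) := by
  choose ν hν using hc
  refine ⟨ν, ?_, by simpa only [hν] using h⟩
  rw [← Nat.cofinite_eq_atTop]
  refine Filter.Tendsto.cofinite_of_finite_preimage_singleton fun n => ?_
  exact (finite_fiber_of_tendsto h (hb n)).subset fun k (hk : ν k = n) => by
    change c k = b n
    rw [← hν, hk]

end Points

/-! ### From selection principles on `C_p(X)` to the weak diagonal principle -/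

section DiagonalLtOne

variable {X : Type u} [TopologicalSpace X]

/-- For `DiagonalLtOne` it suffices to select along a subsequence, from functions that take the
value `1`. -/
theorem DiagonalLtOne.of_subseq
    (h : ∀ g : ℕ → ℕ → X → ℝ, (∀ n m, Continuous (g n m)) → (∀ n m x, g n m x ≤ 1) →
      (∀ n x, Tendsto (fun m => g n m x) atTop (𝓝 0)) → (∀ n m, ∃ x, g n m x = 1) →
      ∃ σ ν : ℕ → ℕ, Tendsto ν atTop atTop ∧
        ∀ x, ∀ᶠ k in atTop, g (ν k) (σ (ν k)) x < 1) : DiagonalLtOne X := by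
  intro g hc h1 h0
  -- Maxima over the rows up to `n`: a column at which a later row is small serves every earlier
  -- row, so selecting along a subsequence is enough.
  set p : ℕ → ℕ → X → ℝ := fun n m => partialSups (fun i => g i m) n with hp
  have hgp : ∀ {i n} m x, i ≤ n → g i m x ≤ p n m x := fun m x hin =>
    le_partialSups_of_le (fun i => g i m) hin x
  have hp1 : ∀ n m x, p n m x ≤ 1 := fun n m x =>
    partialSups_le (fun i => g i m) n (fun _ => 1) (fun i _ x => h1 i m x) x
  have hpmono : ∀ {n n'} m x, n ≤ n' → p n m x ≤ p n' m x := fun m x hn =>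
    (partialSups (fun i => g i m)).monotone hn x
  by_cases H : ∀ n, ∃ m, ∀ x, p n m x < 1
  · choose σ hσ using H
    exact ⟨σ, fun x => Eventually.of_forall fun n => (hgp _ x le_rfl).trans_lt (hσ n x)⟩
  push Not at H
  obtain ⟨N, hN⟩ := H
  -- From row `N` on, every maximum attains the value `1`.
  have hpc : ∀ n m, Continuous (p n m) := fun n m => Continuous.partialSups fun k _ => hc k m
  have hp0 : ∀ n x, Tendsto (fun m => p n m x) atTop (𝓝 0) := fun n x => by
    have : Tendsto (fun m => partialSups (fun i => g i m x) n) atTop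
        (𝓝 (partialSups (fun _ => (0 : ℝ)) n)) :=
      Filter.Tendsto.partialSups_apply fun k _ => h0 k x
    have h00 : partialSups (fun _ => (0 : ℝ)) n = 0 :=
      le_antisymm (partialSups_le _ _ _ fun _ _ => le_rfl) (le_partialSups_of_le (fun _ => (0 : ℝ)) (Nat.zero_le n))
    rw [h00] at this
    simpa only [hp, Pi.partialSups_apply] using this
  have hpone : ∀ n m, ∃ x, p (N + n) m x = 1 := fun n m => by
    obtain ⟨x, hx⟩ := hN m
    exact ⟨x, le_antisymm (hp1 _ m x) (hx.trans (hpmono m x (Nat.le_add_right _ _)))⟩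
  obtain ⟨σ, ν, hν, hx⟩ := h (fun n => p (N + n)) (fun n m => hpc _ m) (fun n m x => hp1 _ m x)
    (fun n x => hp0 _ x) hpone
  have : ∀ n, ∃ k, n ≤ k ∧ n ≤ ν k := fun n =>
    ((eventually_ge_atTop n).and (hν.eventually_ge_atTop n)).exists
  choose κ hκ hνκ using this
  refine ⟨fun n => σ (ν (κ n)), fun x => ?_⟩
  filter_upwards [(tendsto_atTop_mono hκ tendsto_id).eventually (hx x)] with n hn
  exact (hgp _ x ((hνκ n).trans (Nat.le_add_left _ _))).trans_lt hn

/-- The functions equal to an element of `D` where `g m` vanishes and to `1` where `g m` equals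
`1`, interpolating linearly. -/
def blend (D : Set (Cp X)) (g : ℕ → X → ℝ) : Set (Cp X) :=
  {b | ∃ d ∈ D, ∃ m, ∀ x, b.1 x = d.1 x * (1 - g m x) + g m x}

theorem blend_mem_seqDenseSets {D : Set (Cp X)} (hD : D ∈ seqDenseSets (Cp X)) {g : ℕ → X → ℝ}
    (hc : ∀ m, Continuous (g m)) (h0 : ∀ x, Tendsto (fun m => g m x) atTop (𝓝 0)) :
    blend D g ∈ seqDenseSets (Cp X) := by
  refine eq_univ_of_forall fun f => ?_
  obtain ⟨d, hdD, hd⟩ : f ∈ seqClosure D := by rw [hD]; trivial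
  refine ⟨fun m => ⟨fun x => (d m).1 x * (1 - g m x) + g m x,
    ((d m).2.mul (continuous_const.sub (hc m))).add (hc m)⟩,
    fun m => ⟨d m, hdD m, m, fun x => rfl⟩, tendsto_Cp_iff.2 fun x => ?_⟩
  simpa using ((tendsto_Cp_iff.1 hd x).mul ((h0 x).const_sub 1)).add (h0 x)

/-- It suffices that every selection problem for sequentially dense sets has a solution whose range
contains a sequence converging to `0`. -/
theorem DiagonalLtOne.of_seqDense
    (h : ∀ s : ℕ → Set (Cp X), (∀ n, s n ∈ seqDenseSets (Cp X)) → ∃ b c : ℕ → Cp X,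
      (∀ n, b n ∈ s n) ∧ (∀ k, c k ∈ range b) ∧ Tendsto c atTop (𝓝 ⟨fun _ => 0, continuous_const⟩)) :
    DiagonalLtOne X := by
  refine DiagonalLtOne.of_subseq fun g hc h1 h0 hone => ?_
  have huniv : (univ : Set (Cp X)) ∈ seqDenseSets (Cp X) :=
    eq_univ_of_univ_subset subset_seqClosure
  -- A blend is `1` wherever its `g n m` is `1`, so convergence of blends to `0` forces `g n m < 1`
  -- eventually at each point.
  obtain ⟨b, c, hb, hc', hlim⟩ := h (fun n => blend univ (g n))
    fun n => blend_mem_seqDenseSets huniv (hc n) (h0 n)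
  choose d _ σ hσ using hb
  have hb1 : ∀ n x, g n (σ n) x = 1 → (b n).1 x = 1 := fun n x hx => by
    rw [hσ n x, hx]; ring
  have hb0 : ∀ n, b n ≠ ⟨fun _ => 0, continuous_const⟩ := fun n hn => by
    obtain ⟨x, hx⟩ := hone n (σ n)
    have := hb1 n x hx
    rw [hn] at this
    exact zero_ne_one this
  obtain ⟨ν, hν, hlim⟩ := exists_index_tendsto hb0 hc' hlim
  refine ⟨σ, ν, hν, fun x => ?_⟩
  filter_upwards [(tendsto_Cp_iff.1 hlim x).eventually_lt_const (zero_lt_one' ℝ)] with k hk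
  exact lt_of_le_of_ne (h1 _ _ _) fun h => hk.ne (hb1 _ _ h)

theorem DiagonalLtOne.of_S1_seqDense_seqDense
    (h : S1 (seqDenseSets (Cp X)) (seqDenseSets (Cp X))) : DiagonalLtOne X := by
  refine DiagonalLtOne.of_seqDense fun s hs => ?_
  obtain ⟨b, hb, hd⟩ := h s hs
  obtain ⟨c, hc, hlim⟩ : (⟨fun _ => 0, continuous_const⟩ : Cp X) ∈ seqClosure (range b) := by
    rw [hd]; trivial
  exact ⟨b, c, hb, hc, hlim⟩

theorem DiagonalLtOne.of_S1_seqDense_gammaAt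
    (h : ∀ f : Cp X, S1 (seqDenseSets (Cp X)) (gammaAt f)) : DiagonalLtOne X := by
  refine DiagonalLtOne.of_seqDense fun s hs => ?_
  obtain ⟨b, hb, hd⟩ := h ⟨fun _ => 0, continuous_const⟩ s hs
  obtain ⟨c, -, hc, hlim⟩ := exists_seq_of_mem_gammaAt hd
  exact ⟨b, c, hb, hc, hlim⟩

theorem DiagonalLtOne.of_S1_gammaAt_gammaAt
    (h : ∀ f : Cp X, S1 (gammaAt f) (gammaAt f)) : DiagonalLtOne X := by
  refine DiagonalLtOne.of_subseq fun g hc h1 h0 hone => ?_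
  have hne : ∀ n m, (⟨g n m, hc n m⟩ : Cp X) ≠ ⟨fun _ => 0, continuous_const⟩ := fun n m hnm => by
    obtain ⟨x, hx⟩ := hone n m
    have : g n m x = 0 := congrFun (congrArg Subtype.val hnm) x
    linarith
  obtain ⟨b, hb, hd⟩ := h _ (fun n => range fun m => (⟨g n m, hc n m⟩ : Cp X)) fun n =>
    range_mem_gammaAt (tendsto_Cp_iff.2 fun x => h0 n x) (hne n)
  choose σ hσ using hb
  obtain ⟨c, -, hc', hlim⟩ := exists_seq_of_mem_gammaAt hd
  obtain ⟨ν, hν, hlim⟩ := exists_index_tendsto (fun n => hσ n ▸ hne n (σ n)) hc' hlim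
  refine ⟨σ, ν, hν, fun x => ?_⟩
  filter_upwards [(tendsto_Cp_iff.1 hlim x).eventually_lt_const (zero_lt_one' ℝ)] with k hk
  rwa [← hσ] at hk

theorem SeqSeparable.of_S1_seqDense_seqDense
    (h : S1 (seqDenseSets (Cp X)) (seqDenseSets (Cp X))) : SeqSeparable (Cp X) := by
  obtain ⟨b, -, hd⟩ := h (fun _ => univ) fun _ => eq_univ_of_univ_subset subset_seqClosure
  exact ⟨range b, countable_range b, hd⟩

end DiagonalLtOne

/-! ### Strong zero-dimensionality from the weak diagonal principle -/

section ZeroDimensional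

variable {X : Type u} [TopologicalSpace X]

/-- A continuous map of the line onto a set containing the Hilbert cube. -/
theorem exists_continuous_real_covering_cube :
    ∃ G : ℝ → ℕ → ℝ, Continuous G ∧
      ∀ t : ℕ → ℝ, (∀ n, t n ∈ Icc (0 : ℝ) 1) → ∃ c ∈ Icc (0 : ℝ) 1, G c = t := by
  let _ : MetricSpace (ℕ → unitInterval) :=
    TopologicalSpace.metrizableSpaceMetric (ℕ → unitInterval)
  obtain ⟨q, hq, hqs⟩ := exists_nat_bool_continuous_surjective_of_compact (ℕ → unitInterval)
  let F : C(cantorSet, ℕ → ℝ) := ⟨fun c n => (q (cantorSetHomeomorphNatToBool c) n : ℝ), by fun_prop⟩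
  -- The Cantor set maps onto the Hilbert cube; Tietze extends the map to the line.
  obtain ⟨G, hG⟩ := ContinuousMap.exists_restrict_eq isClosed_cantorSet F
  refine ⟨G, G.continuous, fun t ht => ?_⟩
  obtain ⟨a, ha⟩ := hqs fun n => ⟨t n, ht n⟩
  refine ⟨cantorSetHomeomorphNatToBool.symm a, cantorSet_subset_unitInterval (cantorSetHomeomorphNatToBool.symm a).2, ?_⟩
  have := DFunLike.congr_fun hG (cantorSetHomeomorphNatToBool.symm a)
  simp only [ContinuousMap.restrict_apply] at this
  rw [this]
  ext n
  simp [F, ha]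

/-- Bumps of height `1` at `1 / (m + 1)` that converge pointwise to `0`. -/
theorem tendsto_bump (t : ℝ) :
    Tendsto (fun m : ℕ => max 0 (1 - |((m : ℝ) + 1) * t - 1|)) atTop (𝓝 0) := by
  refine tendsto_const_nhds.congr' ?_
  rcases le_or_gt t 0 with ht | ht
  · refine Eventually.of_forall fun m => (max_eq_left ?_).symm
    have : ((m : ℝ) + 1) * t ≤ 0 := mul_nonpos_of_nonneg_of_nonpos (by positivity) ht
    rw [abs_of_neg (by linarith)]
    linarith
  · have h : Tendsto (fun m : ℕ => ((m : ℝ) + 1) * t) atTop atTop :=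
      (tendsto_atTop_add_const_right _ _ tendsto_natCast_atTop_atTop).atTop_mul_const ht
    filter_upwards [h.eventually_ge_atTop 2] with m hm
    refine (max_eq_left ?_).symm
    rw [abs_of_nonneg (by linarith)]
    linarith

theorem DiagonalLtOne.exists_missed [Nonempty X] (h : DiagonalLtOne X) {f : X → ℝ}
    (hf : Continuous f) : ∃ c ∈ Icc (0 : ℝ) 1, ∀ x, f x ≠ c := by
  by_contra! hcov
  obtain ⟨G, hG, hGs⟩ := exists_continuous_real_covering_cube
  obtain ⟨σ, hσ⟩ := h (fun n m x => max 0 (1 - |((m : ℝ) + 1) * G (f x) n - 1|))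
    (fun n m => by fun_prop)
    (fun n m x => max_le zero_le_one (sub_le_self _ (abs_nonneg _))) (fun n x => tendsto_bump _)
  -- At the point of the cube with coordinates `1 / (σ n + 1)`, every selected bump equals `1`.
  obtain ⟨c, hc, hGc⟩ := hGs (fun n => 1 / ((σ n : ℝ) + 1)) fun n =>
    ⟨by positivity, (div_le_one (by positivity)).2 (by linarith [(σ n).cast_nonneg (α := ℝ)])⟩
  obtain ⟨x, rfl⟩ := hcov c hc
  obtain ⟨n, hn⟩ := (hσ x).exists
  rw [hGc] at hn
  have : ((σ n : ℝ) + 1) * (1 / ((σ n : ℝ) + 1)) = 1 := mul_one_div_cancel (by positivity)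
  simp only [this] at hn
  simp at hn

theorem isClopen_setOf_lt {f : X → ℝ} (hf : Continuous f) {c : ℝ} (hc : ∀ x, f x ≠ c) :
    IsClopen {x | c < f x} := by
  refine ⟨?_, isOpen_lt continuous_const hf⟩
  have : {x | c < f x} = {x | c ≤ f x} := by
    ext x; exact ⟨fun h => le_of_lt (a := c) h, fun h => lt_of_le_of_ne h (hc x).symm⟩
  rw [this]
  exact isClosed_le continuous_const hf

theorem StronglyZeroDimensional.of_clopen_refinement
    (h : ∀ (n : ℕ) (U : Fin n → Set X), (∀ i, IsCozeroSet (U i)) → ⋃ i, U i = univ →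
      ∃ W : Fin n → Set X, (∀ i, IsClopen (W i)) ∧ (∀ i, W i ⊆ U i) ∧ ⋃ i, W i = univ) :
    StronglyZeroDimensional X := by
  intro n U hU hcov
  obtain ⟨W, hW, hWU, hWcov⟩ := h n U hU hcov
  refine ⟨n, fun i => W i \ ⋃ j ∈ {j | j < i}, W j, fun i => ?_, fun i => ⟨i, ?_⟩, ?_, ?_⟩
  · exact (hW i).isOpen.sdiff ((Set.toFinite _).isClosed_biUnion fun j _ => (hW j).isClosed)
  · exact sdiff_subset.trans (hWU i)
  · refine eq_univ_of_forall fun x => ?_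
    have hx : ∃ i, x ∈ W i := by rw [← mem_iUnion, hWcov]; trivial
    obtain ⟨i, hi, hmin⟩ := WellFounded.has_min (wellFounded_lt (α := Fin n)) {i | x ∈ W i} hx
    refine mem_iUnion.2 ⟨i, hi, ?_⟩
    simp only [mem_iUnion, not_exists]
    exact fun j hj hxj => hmin j hxj hj
  · intro i j hij
    wlog hlt : i < j generalizing i j
    · exact (this hij.symm (lt_of_le_of_ne (not_lt.1 hlt) hij.symm)).symm
    rw [Set.disjoint_left]
    exact fun x hx hx' => hx'.2 (mem_biUnion hlt hx.1)

theorem DiagonalLtOne.stronglyZeroDimensional [Nonempty X] (h : DiagonalLtOne X) :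
    StronglyZeroDimensional X := by
  refine StronglyZeroDimensional.of_clopen_refinement fun n U hU hcov => ?_
  choose f hf hfU using hU
  have hmem : ∀ i x, x ∈ U i ↔ f i x ≠ 0 := fun i x => by
    have : x ∈ (U i)ᶜ ↔ f i x = 0 := by rw [hfU]; rfl
    rw [← not_iff_not, ← mem_compl_iff, this, not_not]
  have hpos : ∀ x, 0 < ∑ i, |f i x| := fun x => by
    have : x ∈ ⋃ i, U i := by rw [hcov]; trivial
    obtain ⟨i, hi⟩ := mem_iUnion.1 this
    exact Finset.sum_pos' (fun _ _ => abs_nonneg _)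
      ⟨i, Finset.mem_univ _, abs_pos.2 ((hmem i x).1 hi)⟩
  -- These functions are `-1` off `U i`, below any `c i`, and sum to `3n - n = 2n`, so they cannot
  -- all be at most `1`.
  have hcont : ∀ i, Continuous fun x => 3 * n * (|f i x| / ∑ j, |f j x|) - 1 := fun i =>
    (continuous_const.mul ((hf i).abs.div (continuous_finsetSum _ fun j _ => (hf j).abs)
      fun x => (hpos x).ne')).sub continuous_const
  choose c hc hcx using fun i => h.exists_missed (hcont i)
  refine ⟨fun i => {x | c i < 3 * n * (|f i x| / ∑ j, |f j x|) - 1},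
    fun i => isClopen_setOf_lt (hcont i) (hcx i), fun i x hx => ?_, eq_univ_of_forall fun x => ?_⟩
  · rw [hmem]
    intro h0
    have : c i < 3 * n * (|f i x| / ∑ j, |f j x|) - 1 := hx
    rw [h0] at this
    simp at this
    linarith [(hc i).1]
  · by_contra hx
    simp only [mem_iUnion, mem_ofPred_eq, not_exists, not_lt] at hx
    have h1 : ∑ i, |f i x| / ∑ j, |f j x| = 1 := by
      rw [← Finset.sum_div, div_self (hpos x).ne']
    have h2 : ∑ i, (3 * n * (|f i x| / ∑ j, |f j x|) - 1) ≤ ∑ _i : Fin n, (1 : ℝ) :=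
      Finset.sum_le_sum fun i _ => (hx i).trans (hc i).2
    rw [Finset.sum_sub_distrib, ← Finset.mul_sum, h1] at h2
    simp at h2
    have : n ≠ 0 := by
      rintro rfl
      simpa using hpos x
    have : (0 : ℝ) < n := by positivity
    linarith

end ZeroDimensional

/-! ### `γ`-covers and their enumerations -/

section GammaCovers

variable {X : Type u}

theorem range_isGammaCover {U : ℕ → Set X} (hne : ∀ n, U n ≠ univ)
    (hU : ∀ x, ∀ᶠ n in atTop, x ∈ U n) : IsGammaCover (range U) := by
  have hfin : ∀ x, {n | x ∉ U n}.Finite := fun x => by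
    have := hU x
    rw [← Nat.cofinite_eq_atTop] at this
    exact Filter.eventually_cofinite.1 this
  refine ⟨eq_univ_of_forall fun x => ?_, by simpa using hne, fun h => ?_, fun x => ?_⟩
  · obtain ⟨n, hn⟩ := (hU x).exists
    exact ⟨U n, mem_range_self n, hn⟩
  · have huniv : (univ : Set ℕ) = ⋃ V ∈ range U, U ⁻¹' {V} := by
      ext n; simp
    refine Set.infinite_univ (α := ℕ) ?_
    rw [huniv]
    refine h.biUnion ?_
    rintro _ ⟨n, rfl⟩
    obtain ⟨x, hx⟩ := (ne_univ_iff_exists_notMem _).1 (hne n)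
    refine (hfin x).subset fun k (hk : U k = U n) => ?_
    change x ∉ U k
    rwa [hk]
  · refine ((hfin x).image U).subset ?_
    rintro _ ⟨⟨n, rfl⟩, hn⟩
    exact ⟨n, hn, rfl⟩

/-- An injective enumeration of members of a `γ`-cover eventually contains each point. -/
theorem IsGammaCover.eventually_mem {𝒰 : Set (Set X)} (h : IsGammaCover 𝒰) {e : ℕ → Set X}
    (he : Function.Injective e) (hmem : ∀ n, e n ∈ 𝒰) (x : X) : ∀ᶠ n in atTop, x ∈ e n := by
  rw [← Nat.cofinite_eq_atTop, Filter.eventually_cofinite]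
  exact ((h.2.2.2 x).preimage he.injOn).subset fun n hn => ⟨hmem n, hn⟩

end GammaCovers

/-! ### Selection principles for covers -/

section Covers

variable {X : Type u} [TopologicalSpace X]

theorem exists_separating_function {A U : Set X} (hA : IsZeroSet A) (hU : IsCozeroSet U)
    (hAU : A ⊆ U) : ∃ f : X → ℝ, Continuous f ∧ (∀ x, f x ≤ 1) ∧ (∀ x ∈ A, f x = 0) ∧
      ∀ x, f x < 1 → x ∈ U := by
  obtain ⟨a, ha, rfl⟩ := hA
  obtain ⟨b, hb, hbU⟩ := hU
  have hmem : ∀ x, x ∉ U ↔ b x = 0 := fun x => by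
    rw [← mem_compl_iff, hbU]; rfl
  have hpos : ∀ x, 0 < |a x| + |b x| := fun x => by
    by_cases hx : a x = 0
    · have : b x ≠ 0 := fun h => (hmem x).2 h (hAU hx)
      positivity
    · positivity
  refine ⟨fun x => |a x| / (|a x| + |b x|),
    ha.abs.div (ha.abs.add hb.abs) fun x => (hpos x).ne',
    fun x => (div_le_one (hpos x)).2 (le_add_of_nonneg_right (abs_nonneg _)), ?_, fun x hx => ?_⟩
  · intro x (hx : a x = 0)
    simp [hx]
  · by_contra hxU
    rw [hmem] at hxU
    have h := hpos x
    simp only [hxU, abs_zero, add_zero] at hx h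
    exact hx.ne (div_self h.ne')

theorem DiagonalLtOne.S1_shrinkableGamma (h : DiagonalLtOne X) :
    S1 (shrinkableGamma X) (openGamma X) := by
  intro s hs
  choose hγ hcoz F hF hFγ using hs
  -- The shrunken cover is enumerated, not `s n`: `F n` need not be injective, and each point must
  -- eventually lie in the zero-sets.
  have hpre : ∀ n m, ∃ U ∈ s n, F n U = (hFγ n).2.2.1.natEmbedding _ m := fun n m =>
    ((hFγ n).2.2.1.natEmbedding _ m).2
  choose U hUs hUF using hpre
  choose g hgc hg1 hg0 hgU using fun n m =>
    exists_separating_function (hF n _ (hUs n m)).1 (hcoz n _ (hUs n m)) (hF n _ (hUs n m)).2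
  have hev : ∀ n x, ∀ᶠ m in atTop, x ∈ F n (U n m) := fun n x => by
    refine (hFγ n).eventually_mem (fun i j hij => ?_) (fun m => mem_image_of_mem _ (hUs n m)) x
    simp only [hUF] at hij
    exact ((hFγ n).2.2.1.natEmbedding _).injective (Subtype.ext hij)
  obtain ⟨σ, hσ⟩ := h g hgc hg1 fun n x => tendsto_const_nhds.congr' <| by
    filter_upwards [hev n x] with m hm
    exact (hg0 n m x hm).symm
  refine ⟨fun n => U n (σ n), fun n => hUs n _, range_isGammaCover (fun n hn => ?_) fun x => ?_, ?_⟩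
  · exact (hγ n).2.1 (hn ▸ hUs n (σ n))
  · filter_upwards [hσ x] with n hn
    exact hgU _ _ _ hn
  · rintro _ ⟨n, rfl⟩
    obtain ⟨f, hf, hfU⟩ := hcoz n _ (hUs n (σ n))
    rw [← isClosed_compl_iff, hfU]
    exact isClosed_eq hf continuous_const

theorem isZeroSet_of_isClopen {U : Set X} (hU : IsClopen U) : IsZeroSet U := by
  refine ⟨Uᶜ.indicator fun _ => 1, hU.compl.continuous_indicator continuous_const, ?_⟩
  ext x
  simp

theorem S1_clopenGamma_of_S1_shrinkableGamma (h : S1 (shrinkableGamma X) (openGamma X)) :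
    S1 (clopenGamma X) (clopenGamma X) := by
  intro s hs
  obtain ⟨b, hb, hγ⟩ := h s fun n =>
    ⟨(hs n).1, fun U hU => isZeroSet_of_isClopen ((hs n).2 U hU).compl, id,
      fun U hU => ⟨isZeroSet_of_isClopen ((hs n).2 U hU), Subset.rfl⟩, by simpa using (hs n).1⟩
  refine ⟨b, hb, hγ.1, ?_⟩
  rintro _ ⟨n, rfl⟩
  exact (hs n).2 _ (hb n)

end Covers

/-! ### Sequential separability implies property V -/

section Condensation

variable {X : Type u} [TopologicalSpace X]

theorem SeqSeparable.propertyV [T35Space X] (h : SeqSeparable (Cp X)) : PropertyV X := by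
  obtain ⟨D, hD, hDd⟩ := h
  have hseq : ∀ f : Cp X, ∃ d : ℕ → D, ∀ x, Tendsto (fun n => (d n).1.1 x) atTop (𝓝 (f.1 x)) := by
    intro f
    obtain ⟨d, hdD, hd⟩ : f ∈ seqClosure D := by rw [hDd]; trivial
    exact ⟨fun n => ⟨d n, hdD n⟩, tendsto_Cp_iff.1 hd⟩
  have := hD.to_subtype
  let h : X → D → ℝ := fun x d => d.1.1 x
  have hc : Continuous h := continuous_pi fun d => d.1.2
  have hinj : Function.Injective h := by
    intro x y hxy
    by_contra hne
    obtain ⟨f, hf, hfx, hfy⟩ :=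
      CompletelyRegularSpace.completely_regular x {y} isClosed_singleton hne
    obtain ⟨d, hd⟩ := hseq ⟨fun x => f x, continuous_subtype_val.comp hf⟩
    have h1 : f x = f y := Subtype.ext <| tendsto_nhds_unique (hd x) <| by
      refine (hd y).congr fun n => ?_
      exact (congrFun hxy (d n)).symm
    rw [hfx, hfy rfl] at h1
    exact zero_ne_one h1
  let _ : MetricSpace (range h) := TopologicalSpace.metrizableSpaceMetric _
  refine ⟨range h, inferInstance, inferInstance, rangeFactorization h,
    hc.subtype_mk _, ⟨fun x y hxy => hinj (congrArg Subtype.val hxy), rangeFactorization_surjective⟩,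
    fun U hU => ?_⟩
  obtain ⟨f, hf, hfU⟩ := hU
  obtain ⟨d, hd⟩ := hseq ⟨f, hf⟩
  -- If `d n → f` pointwise, then `f x ≠ 0` exactly when `|d n x|` stays above some `1 / (k + 1)`
  -- from index `k` on; this is a closed condition on the coordinates.
  refine ⟨fun k => ⋂ n ≥ k, {y | 1 / ((k : ℝ) + 1) ≤ |y.1 (d n)|}, fun k => ?_, ?_⟩
  · refine isClosed_biInter fun n _ => isClosed_le continuous_const ?_
    exact ((continuous_apply (d n)).comp continuous_subtype_val).abs
  · ext y
    obtain ⟨x, rfl⟩ := rangeFactorization_surjective y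
    have hinj' : Function.Injective (rangeFactorization h) :=
      fun x y hxy => hinj (congrArg Subtype.val hxy)
    have hxU : x ∈ U ↔ f x ≠ 0 := by
      have : x ∈ Uᶜ ↔ f x = 0 := by rw [hfU]; rfl
      rw [← not_iff_not, ← mem_compl_iff, this, not_not]
    rw [hinj'.mem_set_image, hxU, mem_iUnion]
    simp only [mem_iInter]
    constructor
    · intro hx
      have h1 : ∀ᶠ n in atTop, |f x| / 2 < |(d n).1.1 x| :=
        (hd x).abs.eventually_const_lt (half_lt_self (abs_pos.2 hx))
      have h2 : ∀ᶠ k : ℕ in atTop, 1 / ((k : ℝ) + 1) < |f x| / 2 :=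
        tendsto_one_div_add_atTop_nhds_zero_nat.eventually_lt_const (by positivity)
      obtain ⟨k, hk1, hk2⟩ := ((eventually_forall_ge_atTop.2 h1).and h2).exists
      exact ⟨k, fun n hn => (hk2.trans (hk1 n hn)).le⟩
    · rintro ⟨k, hk⟩ h0
      have : 1 / ((k : ℝ) + 1) ≤ |f x| := by
        refine ge_of_tendsto (hd x).abs ?_
        filter_upwards [eventually_ge_atTop k] with n hn using hk n hn
      rw [h0, abs_zero] at this
      exact this.not_gt (by positivity)

end Condensation

/-! ### The strong diagonal principle from clopen covers -/

section ClopenSelection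

variable {X : Type u} [TopologicalSpace X]

/-- Indexed form of the selection principle for clopen `γ`-covers, where repetitions and
the trivial set `X` are allowed. -/
theorem exists_clopen_selection (h : S1 (clopenGamma X) (clopenGamma X)) {U : ℕ → ℕ → Set X}
    (hU : ∀ n m, IsClopen (U n m)) (hx : ∀ n x, ∀ᶠ m in atTop, x ∈ U n m) :
    ∃ σ : ℕ → ℕ, ∀ x, ∀ᶠ n in atTop, x ∈ U n (σ n) := by
  -- Intersecting rows makes `V n m` decrease in `n`: if some row never equals `X`, neither does any
  -- later one, and those rows give genuine `γ`-covers.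
  set V : ℕ → ℕ → Set X := fun n m => ⋂ i ∈ Iic n, U i m with hV
  have hVU : ∀ {i n} m, i ≤ n → V n m ⊆ U i m := fun m hi => biInter_subset_of_mem hi
  have hVV : ∀ {n n'} m, n ≤ n' → V n' m ⊆ V n m := fun m hn =>
    biInter_subset_biInter_left (Iic_subset_Iic.2 hn)
  have hVc : ∀ n m, IsClopen (V n m) := fun n m =>
    (finite_Iic n).isClopen_biInter fun i _ => hU i m
  have hVx : ∀ n x, ∀ᶠ m in atTop, x ∈ V n m := fun n x => by
    filter_upwards [(eventually_all_finite (finite_Iic n)).2 fun i _ => hx i x] with m hm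
    exact mem_iInter₂.2 hm
  by_cases H : ∀ n, ∃ m, V n m = univ
  · choose σ hσ using H
    exact ⟨σ, fun x => Eventually.of_forall fun n => hVU _ le_rfl (hσ n ▸ mem_univ x)⟩
  push Not at H
  obtain ⟨N, hN⟩ := H
  obtain ⟨W, hW, ⟨-, -, hinf, hfin⟩, -⟩ := h (fun n => range (V (N + n))) fun n =>
    ⟨range_isGammaCover (fun m hm => hN m (eq_univ_of_univ_subset
      (hm ▸ hVV m (Nat.le_add_right N n)))) (hVx _), by rintro _ ⟨m, rfl⟩; exact hVc _ _⟩
  choose σ hσ using hW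
  -- `W` may repeat sets. Picking a set not among the first `n` ensures that each of the finitely
  -- many sets missing `x` is eventually avoided.
  have hκ : ∀ n, ∃ k, W k ∉ W '' Iio n := fun n => by
    by_contra! hall
    exact hinf (((finite_Iio n).image W).subset (by rintro _ ⟨k, rfl⟩; exact hall k))
  choose κ hκ using hκ
  have hle : ∀ n, n ≤ κ n := fun n => not_lt.1 fun hlt => hκ n ⟨κ n, hlt, rfl⟩
  refine ⟨fun n => σ (κ n), fun x => ?_⟩
  have hbad : ∀ A ∈ {A ∈ range W | x ∉ A}, ∀ᶠ n in atTop, W (κ n) ≠ A := by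
    rintro _ ⟨⟨j, rfl⟩, -⟩
    filter_upwards [eventually_gt_atTop j] with n hn heq
    exact hκ n ⟨j, hn, heq.symm⟩
  filter_upwards [(eventually_all_finite (hfin x)).2 hbad] with n hn
  have hxW : x ∈ W (κ n) := by
    by_contra hxW
    exact hn _ ⟨mem_range_self _, hxW⟩ rfl
  rw [← hσ] at hxW
  exact hVU _ ((hle n).trans (Nat.le_add_left _ _)) hxW

theorem StronglyZeroDimensional.exists_isClopen_between (h : StronglyZeroDimensional X)
    {g : X → ℝ} (hg : Continuous g) {ε : ℝ} (hε : 0 < ε) :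
    ∃ W : Set X, IsClopen W ∧ (∀ x, |g x| ≤ ε / 2 → x ∈ W) ∧ ∀ x ∈ W, |g x| < ε := by
  obtain ⟨m, V, hVo, hVU, hVcov, hVd⟩ := h 2 ![{x | |g x| < ε}, {x | ε / 2 < |g x|}]
    (by
      intro i
      fin_cases i
      · refine ⟨fun x => max (ε - |g x|) 0, by fun_prop, ?_⟩
        ext x; simp
      · refine ⟨fun x => max (|g x| - ε / 2) 0, by fun_prop, ?_⟩
        ext x; simp)
    (by
      refine eq_univ_of_forall fun x => mem_iUnion.2 ?_
      rcases lt_or_ge (|g x|) ε with hx | hx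
      · exact ⟨0, hx⟩
      · exact ⟨1, (half_lt_self hε).trans_le hx⟩)
  have hcov : ∀ x, ∃ j, x ∈ V j := fun x => by rw [← mem_iUnion, hVcov]; trivial
  -- The pieces lying in `{|g| < ε}`; the remaining pieces form the open complement and lie in `{ε /
  -- 2 < |g|}`.
  refine ⟨⋃ j ∈ {j | V j ⊆ {x | |g x| < ε}}, V j, ⟨?_, ?_⟩, fun x hx => ?_, fun x hx => ?_⟩
  · have : (⋃ j ∈ {j | V j ⊆ {x | |g x| < ε}}, V j)ᶜ =
        ⋃ j ∈ {j | ¬ V j ⊆ {x | |g x| < ε}}, V j := by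
      ext x
      simp only [mem_compl_iff, mem_iUnion, not_exists, mem_ofPred_eq]
      constructor
      · intro hx
        obtain ⟨j, hj⟩ := hcov x
        exact ⟨j, fun hsub => hx j hsub hj, hj⟩
      · rintro ⟨j, hj, hxj⟩ i hi hxi
        have hij : i ≠ j := by rintro rfl; exact hj hi
        exact Set.disjoint_left.1 (hVd hij) hxi hxj
    rw [← isOpen_compl_iff, this]
    exact isOpen_biUnion fun j _ => hVo j
  · exact isOpen_biUnion fun j _ => hVo j
  · obtain ⟨j, hj⟩ := hcov x
    obtain ⟨i, hi⟩ := hVU j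
    refine mem_biUnion (x := j) ?_ hj
    fin_cases i
    · exact hi
    · exact absurd (hi hj) (not_lt.2 hx)
  · obtain ⟨j, hj, hxj⟩ := mem_iUnion₂.1 hx
    exact hj hxj

theorem DiagonalZero.of_S1_clopenGamma (h : S1 (clopenGamma X) (clopenGamma X))
    (hz : StronglyZeroDimensional X) : DiagonalZero X := by
  intro g hg h0
  choose W hW hsub hlt using fun n m =>
    hz.exists_isClopen_between (hg n m) (Nat.one_div_pos_of_nat (α := ℝ) (n := n))
  obtain ⟨σ, hσ⟩ := exists_clopen_selection h hW fun n x => by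
    have := (h0 n x).abs
    rw [abs_zero] at this
    filter_upwards [this.eventually_le_const
      (half_pos (Nat.one_div_pos_of_nat (α := ℝ) (n := n)))] with m hm
    exact hsub n m x hm
  refine ⟨σ, fun x => squeeze_zero_norm' ?_ tendsto_one_div_add_atTop_nhds_zero_nat⟩
  filter_upwards [hσ x] with n hn
  exact (hlt n _ x hn).le

end ClopenSelection

/-! ### Selection principles on `C_p(X)` from the strong diagonal principle -/

section Selectors

variable {X : Type u} [TopologicalSpace X]

/-- Under `DiagonalZero` an iterated limit in `C_p(X)` is a diagonal limit. -/
theorem DiagonalZero.exists_diagonal (h : DiagonalZero X) {A : ℕ → ℕ → Cp X} {f : ℕ → Cp X}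
    {F : Cp X} (hA : ∀ n, Tendsto (A n) atTop (𝓝 (f n))) (hf : Tendsto f atTop (𝓝 F)) :
    ∃ σ : ℕ → ℕ, Tendsto (fun n => A n (σ n)) atTop (𝓝 F) := by
  obtain ⟨σ, hσ⟩ := h (fun n m x => (A n m).1 x - (f n).1 x)
    (fun n m => (A n m).2.sub (f n).2)
    fun n x => by simpa using (tendsto_Cp_iff.1 (hA n) x).sub_const ((f n).1 x)
  refine ⟨σ, tendsto_Cp_iff.2 fun x => ?_⟩
  simpa using (hσ x).add (tendsto_Cp_iff.1 hf x)

theorem DiagonalZero.S1_gammaAt_gammaAt (h : DiagonalZero X) (f : Cp X) :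
    S1 (gammaAt f) (gammaAt f) := by
  intro s hs
  choose A _ hAs hA using fun n => exists_seq_of_mem_gammaAt (hs n)
  obtain ⟨σ, hσ⟩ := h.exists_diagonal hA tendsto_const_nhds
  exact ⟨fun n => A n (σ n), fun n => hAs _ _,
    range_mem_gammaAt hσ fun n hn => (hs n).2.1 (hn ▸ hAs n (σ n))⟩

theorem DiagonalZero.S1_seqDense_gammaAt [Nonempty X] (h : DiagonalZero X) (f : Cp X) :
    S1 (seqDenseSets (Cp X)) (gammaAt f) := by
  intro s hs
  -- Sequentially dense sets may contain `f`; aiming at `F n ≠ f` keeps the selected functions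
  -- different from `f`.
  let F : ℕ → Cp X := fun n => ⟨fun x => f.1 x + 1 / ((n : ℝ) + 1), f.2.add continuous_const⟩
  have hF : Tendsto F atTop (𝓝 f) := tendsto_Cp_iff.2 fun x => by
    simpa [F] using tendsto_one_div_add_atTop_nhds_zero_nat.const_add (f.1 x)
  have hFf : ∀ n, F n ≠ f := fun n hn => by
    obtain ⟨x⟩ := ‹Nonempty X›
    have h1 : f.1 x + 1 / ((n : ℝ) + 1) = f.1 x := congrFun (congrArg Subtype.val hn) x
    have h2 := Nat.one_div_pos_of_nat (α := ℝ) (n := n)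
    linarith
  have hex : ∀ n, ∃ a : ℕ → Cp X, (∀ m, a m ∈ s n) ∧ (∀ m, a m ≠ f) ∧
      Tendsto a atTop (𝓝 (F n)) := fun n => by
    obtain ⟨a, ha, hlim⟩ : F n ∈ seqClosure (s n) := by rw [hs n]; trivial
    obtain ⟨k, hk⟩ := eventually_atTop.1 (hlim.eventually_ne (hFf n))
    exact ⟨fun m => a (m + k), fun m => ha _, fun m => hk _ (Nat.le_add_left _ _),
      hlim.comp (tendsto_add_atTop_nat k)⟩
  choose A hAs hAf hA using hex
  obtain ⟨σ, hσ⟩ := h.exists_diagonal hA hF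
  exact ⟨fun n => A n (σ n), fun n => hAs _ _, range_mem_gammaAt hσ fun n => hAf _ _⟩

theorem DiagonalZero.S1_seqDense_seqDense (h : DiagonalZero X) (hsep : SeqSeparable (Cp X)) :
    S1 (seqDenseSets (Cp X)) (seqDenseSets (Cp X)) := by
  intro s hs
  obtain ⟨D, hDc, hD⟩ := hsep
  have hne : D.Nonempty := by
    obtain ⟨d, hd, -⟩ : (⟨fun _ => 0, continuous_const⟩ : Cp X) ∈ seqClosure D := by
      rw [hD]; trivial
    exact ⟨d 0, hd 0⟩
  obtain ⟨d, rfl⟩ := hDc.exists_eq_range hne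
  -- Pairing reserves infinitely many of the given sets for each `d k`. One diagonal makes the
  -- choices converge to each `d k`, a second reaches an arbitrary `f`.
  have hex : ∀ k n, ∃ a : ℕ → Cp X, (∀ m, a m ∈ s (Nat.pair k n)) ∧
      Tendsto a atTop (𝓝 (d k)) := fun k n => by
    have : d k ∈ seqClosure (s (Nat.pair k n)) := by rw [hs]; trivial
    exact this
  choose A hAs hA using hex
  choose σ hσ using fun k => h.exists_diagonal (hA k) tendsto_const_nhds
  refine ⟨fun N => A N.unpair.1 N.unpair.2 (σ N.unpair.1 N.unpair.2), fun N => ?_,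
    eq_univ_of_forall fun f => ?_⟩
  · simpa using hAs N.unpair.1 N.unpair.2 (σ N.unpair.1 N.unpair.2)
  · obtain ⟨e, he, hlim⟩ : f ∈ seqClosure (range d) := by rw [hD]; trivial
    choose κ hκ using he
    obtain ⟨τ, hτ⟩ := h.exists_diagonal (fun i => hσ (κ i))
      (show Tendsto (fun i => d (κ i)) atTop (𝓝 f) by simpa only [hκ] using hlim)
    exact ⟨_, fun i => ⟨Nat.pair (κ i) (τ i), by simp⟩, hτ⟩

end Selectors

/-! ### Continuous imitations of step functions -/

section Cascade

variable {X : Type u}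

/-- Product of the functions `1 - min 1 (N * b j)` over a finite set of indices. -/
def plateau (b : ℕ → X → ℝ) (J : Finset ℕ) (N : ℕ) (x : X) : ℝ :=
  ∏ j ∈ J, (1 - min 1 (N * b j x))

/-- The function whose value is prescribed by the first entry of a list whose plateau function
is `1`, provided that the plateau functions before it vanish. -/
def cascade (b : ℕ → X → ℝ) : List (ℚ × Finset ℕ × ℕ) → X → ℝ
  | [], _ => 0
  | (c, J, N) :: l, x => c * plateau b J N x + (1 - plateau b J N x) * cascade b l x

theorem continuous_cascade [TopologicalSpace X] {b : ℕ → X → ℝ} (hb : ∀ j, Continuous (b j))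
    (l : List (ℚ × Finset ℕ × ℕ)) : Continuous (cascade b l) := by
  induction l with
  | nil => exact continuous_const
  | cons p l ih =>
    obtain ⟨c, J, N⟩ := p
    have : Continuous (plateau b J N) := by unfold plateau; fun_prop
    exact (continuous_const.mul this).add ((continuous_const.sub this).mul ih)

theorem cascade_append {b : ℕ → X → ℝ} {x : X} (l₁ l₂ : List (ℚ × Finset ℕ × ℕ))
    (p : ℚ × Finset ℕ × ℕ) (h0 : ∀ q ∈ l₁, plateau b q.2.1 q.2.2 x = 0)
    (h1 : plateau b p.2.1 p.2.2 x = 1) : cascade b (l₁ ++ p :: l₂) x = p.1 := by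
  induction l₁ with
  | nil => simp [cascade, h1]
  | cons q l ih =>
    rw [List.cons_append, cascade, h0 q List.mem_cons_self,
      ih fun q hq => h0 q (List.mem_cons_of_mem _ hq)]
    ring

open Classical in
/-- The cascade following the first `m` sets of the sequence `H`, with values `c`. -/
noncomputable def hitList (b : ℕ → X → ℝ) (H : ℕ → Set X) (c : ℕ → ℚ) (m : ℕ) : List (ℚ × Finset ℕ × ℕ) :=
  (List.range m).map fun k => (c k, (Finset.range m).filter fun j => ∀ y ∈ H k, b j y = 0, m)

/-- The plateau of `H k` is `1` on `H k`, and at a point outside it vanishes for large `m`. So the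
cascade eventually reads off the value of the first set containing `x`. -/
theorem eventually_cascade_hitList {b : ℕ → X → ℝ} {H : ℕ → Set X} (c : ℕ → ℚ) {x : X}
    (hsep : ∀ k, x ∉ H k → ∃ j, (∀ y ∈ H k, b j y = 0) ∧ 0 < b j x) (hx : ∃ k, x ∈ H k) :
    ∃ k, x ∈ H k ∧ ∀ᶠ m in atTop, cascade b (hitList b H c m) x = c k := by
  classical
  refine ⟨Nat.find hx, Nat.find_spec hx, ?_⟩
  set K := Nat.find hx
  have hzero : ∀ k ∈ Iio K, ∀ᶠ m : ℕ in atTop,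
      plateau b ((Finset.range m).filter fun j => ∀ y ∈ H k, b j y = 0) m x = 0 := by
    intro k hk
    obtain ⟨j, hj, hpos⟩ := hsep k (Nat.find_min hx hk)
    filter_upwards [eventually_gt_atTop j,
      (tendsto_natCast_atTop_atTop.atTop_mul_const hpos).eventually_ge_atTop 1] with m hm hm1
    refine Finset.prod_eq_zero (i := j) (by simpa using ⟨hm, hj⟩) ?_
    rw [min_eq_left hm1, sub_self]
  filter_upwards [(eventually_all_finite (finite_Iio K)).2 hzero, eventually_gt_atTop K]
    with m hm hK
  obtain ⟨r, rfl⟩ := Nat.exists_eq_add_of_lt hK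
  unfold hitList
  rw [show K + r + 1 = K + (r + 1) by ring] at hm ⊢
  rw [List.range_add, List.map_append, List.range_succ_eq_map, List.map_cons, List.map_cons,
    cascade_append]
  · simp
  · simp only [List.mem_map, List.mem_range]
    rintro _ ⟨k, hk, rfl⟩
    exact hm k hk
  · refine Finset.prod_eq_one fun j hj => ?_
    have : b j x = 0 := (Finset.mem_filter.1 hj).2 x (Nat.find_spec hx)
    simp [this]

end Cascade

/-! ### Property V implies sequential separability -/

section Condensation

variable {X : Type u} [TopologicalSpace X]

theorem exists_separating_sequence (Y : Type*) [MetricSpace Y] [TopologicalSpace.SeparableSpace Y]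
    [Nonempty Y] : ∃ b : ℕ → Y → ℝ, (∀ j, Continuous (b j)) ∧
      ∀ H : Set Y, IsClosed H → ∀ x ∉ H, ∃ j, (∀ y ∈ H, b j y = 0) ∧ 0 < b j x := by
  -- Tents of radius `1 / (k + 1)` at dense points; once the radius is below `ε / 2`, a tent
  -- positive at `x` vanishes outside the `ε`-ball.
  refine ⟨fun j y => max 0 (1 / ((j.unpair.2 : ℝ) + 1) -
    dist y (TopologicalSpace.denseSeq Y j.unpair.1)), fun j => by fun_prop, fun H hH x hx => ?_⟩
  obtain ⟨ε, hε, hball⟩ := Metric.isOpen_iff.1 hH.isOpen_compl x hx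
  obtain ⟨k, hk⟩ := exists_nat_one_div_lt (half_pos hε)
  obtain ⟨i, hi⟩ := (TopologicalSpace.denseRange_denseSeq Y).exists_dist_lt x
    (Nat.one_div_pos_of_nat (α := ℝ) (n := k))
  refine ⟨Nat.pair i k, fun y hy => ?_, ?_⟩
  · simp only [Nat.unpair_pair]
    refine max_eq_left ?_
    have h1 : ε ≤ dist y x := not_lt.1 fun hlt => hball hlt hy
    have h2 := dist_triangle_right y x (TopologicalSpace.denseSeq Y i)
    linarith
  · simp only [Nat.unpair_pair]
    exact lt_max_of_lt_right (sub_pos.2 hi)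

theorem PropertyV.seqSeparable [Nonempty X] (hV : PropertyV X) (h : DiagonalZero X) :
    SeqSeparable (Cp X) := by
  obtain ⟨Y, _, _, φ, hφ, hbij, hFσ⟩ := hV
  have : Nonempty Y := ‹Nonempty X›.map φ
  obtain ⟨b, hb, hsep⟩ := exists_separating_sequence Y
  have hbφ : ∀ j, Continuous (b j ∘ φ) := fun j => (hb j).comp hφ
  let E : List (ℚ × Finset ℕ × ℕ) → Cp X := fun l =>
    ⟨cascade (fun j => b j ∘ φ) l, continuous_cascade hbφ l⟩
  refine ⟨range E, countable_range E, eq_univ_of_forall fun f => ?_⟩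
  have happrox : ∀ i : ℕ, ∃ l : ℕ → List (ℚ × Finset ℕ × ℕ), ∀ x, ∀ᶠ m in atTop,
      |(E (l m)).1 x - f.1 x| < 1 / ((i : ℝ) + 1) := by
    intro i
    have hε := Nat.one_div_pos_of_nat (α := ℝ) (n := i)
    -- Property V splits each set where a rational `c` approximates `f` into closed pieces of `Y`; a
    -- cascade over all pieces takes an admissible `c` at every point.
    choose F hF hUF using fun c : ℚ => hFσ {x | |c - f.1 x| < 1 / ((i : ℝ) + 1)}
      ⟨fun x => max (1 / ((i : ℝ) + 1) - |c - f.1 x|) 0,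
        (continuous_const.sub (continuous_const.sub f.2).abs).max continuous_const, by
          ext x; simp⟩
    obtain ⟨e, he⟩ := exists_surjective_nat (ℚ × ℕ)
    refine ⟨hitList (fun j => b j ∘ φ) (fun k => φ ⁻¹' F (e k).1 (e k).2) fun k => (e k).1,
      fun x => ?_⟩
    have hmem : ∀ c : ℚ, |c - f.1 x| < 1 / ((i : ℝ) + 1) ↔ ∃ n, φ x ∈ F c n := fun c => by
      rw [← mem_iUnion, ← hUF, hbij.1.mem_set_image]; rfl
    obtain ⟨k, hk, hev⟩ := eventually_cascade_hitList (b := fun j => b j ∘ φ)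
      (H := fun k => φ ⁻¹' F (e k).1 (e k).2) (fun k => (e k).1) (x := x)
      (fun k hk => by
        obtain ⟨j, hj, hpos⟩ := hsep _ (hF (e k).1 (e k).2) (φ x) hk
        exact ⟨j, fun y hy => hj _ hy, hpos⟩)
      (by
        obtain ⟨c, hc1, hc2⟩ := exists_rat_btwn
          (show f.1 x - 1 / ((i : ℝ) + 1) < f.1 x by linarith)
        obtain ⟨n, hn⟩ := (hmem c).1 (by rw [abs_sub_lt_iff]; constructor <;> linarith)
        obtain ⟨k, hk⟩ := he (c, n)
        exact ⟨k, by simpa [hk] using hn⟩)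
    filter_upwards [hev] with m hm
    change |cascade _ _ x - _| < _
    rw [hm]
    exact (hmem _).2 ⟨_, hk⟩
  choose l hl using happrox
  -- Only the excess of the error over `1 / (i + 1)` tends to `0` in `m`, so the diagonal principle
  -- is applied to it.
  obtain ⟨σ, hσ⟩ := h (fun i m x => max (|(E (l i m)).1 x - f.1 x| - 1 / ((i : ℝ) + 1)) 0)
    (fun i m => (((E (l i m)).2.sub f.2).abs.sub continuous_const).max continuous_const)
    fun i x => tendsto_const_nhds.congr' <| by
      filter_upwards [hl i x] with m hm
      exact (max_eq_right (by linarith)).symm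
  refine ⟨fun i => E (l i (σ i)), fun i => mem_range_self _, tendsto_Cp_iff.2 fun x => ?_⟩
  rw [tendsto_iff_norm_sub_tendsto_zero]
  have hlim := (hσ x).add tendsto_one_div_add_atTop_nhds_zero_nat
  rw [add_zero] at hlim
  refine squeeze_zero (fun _ => norm_nonneg _) (fun i => ?_) hlim
  rw [Real.norm_eq_abs]
  linarith [le_max_left (|(E (l i (σ i))).1 x - f.1 x| - 1 / ((i : ℝ) + 1)) 0]

end Condensation

end SelCp

theorem mainTheorem4 (X : Type u) [TopologicalSpace X] [T35Space X] [Nonempty X] :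
    List.TFAE [
      SelCp.S1 (SelCp.seqDenseSets (SelCp.Cp X)) (SelCp.seqDenseSets (SelCp.Cp X)),
      SelCp.S1 (SelCp.shrinkableGamma X) (SelCp.openGamma X) ∧ SelCp.PropertyV X ∧
        SelCp.StronglyZeroDimensional X,
      SelCp.S1 (SelCp.clopenGamma X) (SelCp.clopenGamma X) ∧ SelCp.PropertyV X ∧
        SelCp.StronglyZeroDimensional X,
      (∀ f : SelCp.Cp X, SelCp.S1 (SelCp.gammaAt f) (SelCp.gammaAt f)) ∧
        SelCp.SeqSeparable (SelCp.Cp X),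
      (∀ f : SelCp.Cp X, SelCp.S1 (SelCp.seqDenseSets (SelCp.Cp X)) (SelCp.gammaAt f)) ∧
        SelCp.SeqSeparable (SelCp.Cp X)] := by
  have toCovers (h : SelCp.DiagonalLtOne X) (hs : SelCp.SeqSeparable (SelCp.Cp X)) :
      SelCp.S1 (SelCp.shrinkableGamma X) (SelCp.openGamma X) ∧ SelCp.PropertyV X ∧
        SelCp.StronglyZeroDimensional X :=
    ⟨h.S1_shrinkableGamma, hs.propertyV, h.stronglyZeroDimensional⟩
  have ofCovers (h : SelCp.S1 (SelCp.clopenGamma X) (SelCp.clopenGamma X) ∧ SelCp.PropertyV X ∧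
      SelCp.StronglyZeroDimensional X) :
      SelCp.DiagonalZero X ∧ SelCp.SeqSeparable (SelCp.Cp X) :=
    have hd := SelCp.DiagonalZero.of_S1_clopenGamma h.1 h.2.2
    ⟨hd, h.2.1.seqSeparable hd⟩
  tfae_have 1 → 2 := fun h =>
    toCovers (.of_S1_seqDense_seqDense h) (.of_S1_seqDense_seqDense h)
  tfae_have 4 → 2 := fun h => toCovers (.of_S1_gammaAt_gammaAt h.1) h.2
  tfae_have 5 → 2 := fun h => toCovers (.of_S1_seqDense_gammaAt h.1) h.2
  tfae_have 2 → 3 := fun h => ⟨SelCp.S1_clopenGamma_of_S1_shrinkableGamma h.1, h.2⟩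
  tfae_have 3 → 1 := fun h => (ofCovers h).1.S1_seqDense_seqDense (ofCovers h).2
  tfae_have 3 → 4 := fun h => ⟨(ofCovers h).1.S1_gammaAt_gammaAt, (ofCovers h).2⟩
  tfae_have 3 → 5 := fun h => ⟨(ofCovers h).1.S1_seqDense_gammaAt, (ofCovers h).2⟩
  tfae_finish
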